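/- Let $\mathcal M=(N,\mathcal I)$ be a matroid on a finite ground set $N$ with $n=|N|\ge 1$ elements, let $P_{\mathcal I}\subseteq[0,1]^N$ be its matroid polytope, i.e. the convex hull of the characteristic vectors of the independent sets, and let $b\in(0,1]$. For $x\in[0,1]^N$, write $\mathrm{support}(x)=\{i\in N: x_i>0\}$ and let $R(x)\subseteq N$ be the random set that contains each $i\in N$ independently with probability $x_i$. For $c\in[0,1]$, a $(b,c)$-balanced contention resolution (CR) scheme for $P_{\mathcal I}$ is a procedure $\pi$ that for every $x\in b\,P_{\mathcal I}=\{b\,p: p\in P_{\mathcal I}\}$ and every $A\subseteq N$ returns a random set $\pi_x(A)$ (using randomness independent of $R(x)$) such that (i) $\pi_x(A)\subseteq A\cap\mathrm{support}(x)$ and $\pi_x(A)\in\mathcal I$ with probability $1$, and (ii) $\Pr[\,i\in\pi_x(R(x))\mid i\in R(x)\,]\ge c$ for all $i\in\mathrm{support}(x)$. Then there exists a $\left(b,\ \dfrac{1-\left(1-\frac{b}{n}\right)^n}{b}\right)$-balanced CR scheme for $P_{\mathcal I}$. -/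

import Mathlib

open scoped Pointwise

/-- The characteristic vector `1_S ∈ {0,1}^N` of a set `S ⊆ N`. -/
def charVec {N : Type*} [DecidableEq N] (S : Finset N) : N → ℝ :=
  fun i => if i ∈ S then 1 else 0

/-- The polytope `P_I`: the convex hull of the characteristic vectors of the members of the
family `I ⊆ 2^N`. -/
def feasiblePolytope {N : Type*} [DecidableEq N] (I : Set (Finset N)) : Set (N → ℝ) :=
  convexHull ℝ (charVec '' I)

/-- The family of independent sets of a matroid. -/
def indepSets {N : Type*} (M : Matroid N) : Set (Finset N) := {S | M.Indep (S : Set N)}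

/-- `P_I` lies in the cube `[0,1]^N`. -/
theorem feasiblePolytope_subset_cube {N : Type*} [DecidableEq N] (I : Set (Finset N)) :
    feasiblePolytope I ⊆ Set.Icc (0 : N → ℝ) 1 := by
  refine convexHull_min ?_ (convex_Icc _ _)
  rintro _ ⟨S, -, rfl⟩
  refine ⟨fun i => ?_, fun i => ?_⟩ <;> by_cases h : i ∈ S <;> simp [charVec, h]

/-- For `b ∈ [0,1]`, the scaled polytope `b P_I` lies in the cube `[0,1]^N`. -/
theorem smul_feasiblePolytope_mem_cube {N : Type*} [DecidableEq N] {I : Set (Finset N)} {b : ℝ}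
    (hb : b ∈ Set.Icc (0 : ℝ) 1) {x : N → ℝ} (hx : x ∈ b • feasiblePolytope I) (i : N) :
    x i ∈ Set.Icc (0 : ℝ) 1 := by
  obtain ⟨p, hp, rfl⟩ := hx
  have h := feasiblePolytope_subset_cube I hp
  exact ⟨mul_nonneg hb.1 (h.1 i), mul_le_one₀ hb.2 (h.1 i) (h.2 i)⟩

/-- The probability that the random set `R(x)`, which contains each `i ∈ N` independently with
probability `x i`, equals `A`. -/
def independentMass {N : Type*} [Fintype N] [DecidableEq N] (x : N → ℝ) (A : Finset N) : ℝ :=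
  ∏ i, if i ∈ A then x i else 1 - x i

theorem independentMass_nonneg {N : Type*} [Fintype N] [DecidableEq N] {x : N → ℝ}
    (hx : ∀ i, x i ∈ Set.Icc (0 : ℝ) 1) (A : Finset N) : 0 ≤ independentMass x A := by
  refine Finset.prod_nonneg fun i _ => ?_
  split_ifs
  · exact (hx i).1
  · exact sub_nonneg.2 (hx i).2

theorem sum_independentMass {N : Type*} [Fintype N] [DecidableEq N] (x : N → ℝ) :
    ∑ A : Finset N, independentMass x A = 1 := by
  have h := Fintype.prod_add x (fun i => 1 - x i)
  simp only [add_sub_cancel, Finset.prod_const_one] at h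
  rw [h]
  refine Finset.sum_congr rfl fun A _ => ?_
  simp only [independentMass, Finset.prod_ite]
  congr 1
  · exact Finset.prod_congr (by ext; simp) fun _ _ => rfl
  · exact Finset.prod_congr (by ext; simp) fun _ _ => rfl

/-- The law of the random set `R(x)` containing each `i ∈ N` independently with
probability `x i`. -/
noncomputable def randomSet {N : Type*} [Fintype N] [DecidableEq N] (x : N → ℝ)
    (hx : ∀ i, x i ∈ Set.Icc (0 : ℝ) 1) : PMF (Finset N) :=
  PMF.ofFintype (fun A => ENNReal.ofReal (independentMass x A)) (by
    rw [← ENNReal.ofReal_sum_of_nonneg fun A _ => independentMass_nonneg hx A,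
      sum_independentMass, ENNReal.ofReal_one])

/-- The joint law of `(R, π(R))`: first `R` is drawn from `ρ`, then, given `R`, the set `π(R)`
is drawn from the distribution `π R`, with fresh randomness. -/
noncomputable def jointLaw {N : Type*} (ρ : PMF (Finset N)) (π : Finset N → PMF (Finset N)) :
    PMF (Finset N × Finset N) :=
  ρ.bind fun R => (π R).map fun J => (R, J)

/-- The probability of the event `s` under a discrete law. -/
noncomputable def probOf {Ω : Type*} (p : PMF Ω) (s : Set Ω) : ℝ := (p.toOuterMeasure s).toReal

/-- The conditional probability `Pr[s | t]` under a discrete law, for `t` of positive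
probability. -/
noncomputable def condProbOf {Ω : Type*} (p : PMF Ω) (s t : Set Ω) : ℝ :=
  probOf p (s ∩ t) / probOf p t

/-- `π` is a `(b,c)`-balanced contention resolution scheme for `P_I`, where `b, c ∈ [0,1]`.
For every `x ∈ b P_I` and `A ⊆ N`, the random set `π_x(A)` has law `π x A`. -/
structure IsBalancedCRScheme {N : Type*} [Fintype N] [DecidableEq N] (I : Set (Finset N))
    (b c : ℝ) (π : (N → ℝ) → Finset N → PMF (Finset N)) : Prop where
  b_mem : b ∈ Set.Icc (0 : ℝ) 1
  c_mem : c ∈ Set.Icc (0 : ℝ) 1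
  /-- With probability one, `π_x(A)` is a subset of `A ∩ support(x)`. -/
  subset : ∀ x ∈ b • feasiblePolytope I, ∀ A : Finset N, ∀ J ∈ (π x A).support,
    ∀ i ∈ J, i ∈ A ∧ 0 < x i
  /-- With probability one, `π_x(A)` is in `I`. -/
  feasible : ∀ x ∈ b • feasiblePolytope I, ∀ A : Finset N, ∀ J ∈ (π x A).support, J ∈ I
  /-- `Pr[i ∈ π_x(R(x)) | i ∈ R(x)] ≥ c` for every `i ∈ support(x)`. -/
  balanced : ∀ (x : N → ℝ) (hx : x ∈ b • feasiblePolytope I) (i : N), 0 < x i →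
    c ≤ condProbOf
      (jointLaw (randomSet x (smul_feasiblePolytope_mem_cube b_mem hx)) (π x))
      {ω | i ∈ ω.2} {ω | i ∈ ω.1}

/-! Fix `x = b p`, and let `c` be the claimed ratio. The marginal vectors `Pr[i ∈ π(R)]` attainable
by schemes form a compact convex set. If none dominated `c x`, a hyperplane with nonnegative normal
`y` would separate them (`exists_dominating_selection`). So it is enough, for each `y ≥ 0`, to pick
an independent subset of `R` of expected weight at least `c ∑ y_i x_i`. The best pick weighs `f(R)`,
with `f` the weighted rank function, which is monotone submodular (`Matroid.exists_weighted_rank`).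

What remains is a correlation gap: `E f(R(bp)) ≥ (1 - (1 - b/n)^n) ∑ y_i p_i`. Write `p = ∑ β_S 1_S`
with at most `n` independent sets and `∑ β_S ≤ 1` (`exists_conic_combination_card_le`). Drawing
these sets independently with probabilities `b β_S` and taking their union yields at most `E
f(R(bp))` (`MonoSubmodular.bernoulliExp_biUnion_le`), and the union is worth at least its best
member. Cutting the values `f(S)` into layers reduces the expected best member to the probability of
hitting a family `J`, where AM-GM and convexity give `1 - ∏ (1 - b β_S) ≥ (1 - (1 - b/n)^n) β(J)`
(`mul_sum_le_one_sub_prod`). -/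

/-! ### Expectations over independent choices, of elements or of whole sets. -/

/-- The expectation of `f` over the random subset of `s` that contains each `i ∈ s`
independently with probability `x i`. -/
def bernoulliExp {ι : Type*} [DecidableEq ι] (x : ι → ℝ) (s : Finset ι)
    (f : Finset ι → ℝ) : ℝ :=
  ∑ A ∈ s.powerset, (∏ i ∈ s, if i ∈ A then x i else 1 - x i) * f A

section BernoulliExp

variable {ι : Type*} [DecidableEq ι]

theorem bernoulliExp_empty (x : ι → ℝ) (f : Finset ι → ℝ) :
    bernoulliExp x ∅ f = f ∅ := by
  simp [bernoulliExp]

/-- Conditioning on whether `e` is chosen; this drives the inductions on `s`. -/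
theorem bernoulliExp_insert (x : ι → ℝ) {e : ι} {s : Finset ι} (he : e ∉ s)
    (f : Finset ι → ℝ) :
    bernoulliExp x (insert e s) f =
      (1 - x e) * bernoulliExp x s f + x e * bernoulliExp x s (fun A => f (insert e A)) := by
  unfold bernoulliExp
  rw [Finset.sum_powerset_insert he, Finset.mul_sum, Finset.mul_sum]
  congr 1 <;> refine Finset.sum_congr rfl fun A hA => ?_
  · have : e ∉ A := fun h => he (Finset.mem_powerset.1 hA h)
    rw [Finset.prod_insert he, if_neg this, mul_assoc]
  · rw [Finset.prod_insert he, if_pos (Finset.mem_insert_self e A), mul_assoc]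
    congr 2
    refine Finset.prod_congr rfl fun i hi => ?_
    have : i ≠ e := fun h => he (h ▸ hi)
    simp [this]

theorem bernoulliExp_mono {x : ι → ℝ} {s : Finset ι} (hx : ∀ i ∈ s, x i ∈ Set.Icc (0 : ℝ) 1)
    {f g : Finset ι → ℝ} (h : ∀ A, f A ≤ g A) : bernoulliExp x s f ≤ bernoulliExp x s g := by
  refine Finset.sum_le_sum fun A _ => mul_le_mul_of_nonneg_left (h A) ?_
  refine Finset.prod_nonneg fun i hi => ?_
  split_ifs
  · exact (hx i hi).1
  · exact sub_nonneg.2 (hx i hi).2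

theorem bernoulliExp_add (x : ι → ℝ) (s : Finset ι) (f g : Finset ι → ℝ) :
    bernoulliExp x s (fun A => f A + g A) = bernoulliExp x s f + bernoulliExp x s g := by
  simp [bernoulliExp, mul_add, Finset.sum_add_distrib]

theorem bernoulliExp_smul (x : ι → ℝ) (s : Finset ι) (c : ℝ) (f : Finset ι → ℝ) :
    bernoulliExp x s (fun A => c * f A) = c * bernoulliExp x s f := by
  simp only [bernoulliExp, Finset.mul_sum]
  exact Finset.sum_congr rfl fun A _ => by ring

theorem bernoulliExp_const (x : ι → ℝ) (s : Finset ι) (c : ℝ) :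
    bernoulliExp x s (fun _ => c) = c := by
  induction s using Finset.induction_on with
  | empty => exact bernoulliExp_empty _ _
  | insert e s he ih => rw [bernoulliExp_insert x he, ih]; ring

theorem bernoulliExp_hit (x : ι → ℝ) (s J : Finset ι) :
    bernoulliExp x s (fun A => if Disjoint A J then 0 else 1) =
      1 - ∏ i ∈ s ∩ J, (1 - x i) := by
  induction s using Finset.induction_on with
  | empty => simp [bernoulliExp_empty]
  | insert e s he ih =>
    rw [bernoulliExp_insert x he, ih]
    by_cases h : e ∈ J
    · have h' : ∀ A : Finset ι, ¬ Disjoint (insert e A) J := fun A hA =>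
        Finset.disjoint_left.1 hA (Finset.mem_insert_self e A) h
      simp only [h', if_false, bernoulliExp_const]
      rw [Finset.insert_inter_of_mem h, Finset.prod_insert (by simp [he])]
      ring
    · simp only [Finset.disjoint_insert_left, h, not_false_eq_true, true_and, ih,
        Finset.insert_inter_of_notMem h]
      ring

theorem bernoulliExp_mem (x : ι → ℝ) {s : Finset ι} {i : ι} (hi : i ∈ s) :
    bernoulliExp x s (fun A => if i ∈ A then 1 else 0) = x i := by
  have h := bernoulliExp_hit x s {i}
  simp only [Finset.disjoint_singleton_right, ite_not, Finset.inter_singleton_of_mem hi,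
    Finset.prod_singleton, sub_sub_cancel] at h
  exact h

end BernoulliExp

theorem sum_independentMass_mul {N : Type*} [Fintype N] [DecidableEq N] (x : N → ℝ)
    (f : Finset N → ℝ) :
    ∑ A, independentMass x A * f A = bernoulliExp x Finset.univ f := by
  simp [bernoulliExp, independentMass]

/-! ### Submodularity: choosing sets as blocks versus choosing elements. -/

/-- A monotone submodular set function. -/
structure MonoSubmodular {N : Type*} [DecidableEq N] (f : Finset N → ℝ) : Prop where
  mono : ∀ ⦃A B⦄, A ⊆ B → f A ≤ f B
  submod : ∀ A B C, f (A ∪ B ∪ C) + f A ≤ f (A ∪ B) + f (A ∪ C)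

namespace MonoSubmodular

variable {N : Type*} [DecidableEq N] {f : Finset N → ℝ}

/-- Closure under forcing elements in, which allows induction hypotheses that quantify over `f`. -/
theorem union_left (hf : MonoSubmodular f) (D : Finset N) :
    MonoSubmodular (fun A => f (D ∪ A)) where
  mono _ _ h := hf.mono (Finset.union_subset_union_right h)
  submod A B C := by
    simpa only [Finset.union_assoc] using hf.submod (D ∪ A) B C

theorem insert_left (hf : MonoSubmodular f) (e : N) :
    MonoSubmodular (fun A => f (insert e A)) := by
  simpa only [Finset.insert_eq] using hf.union_left {e}

/-- Adding `S` as a block with probability `β` is no better than giving each of its elements the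
extra probability `β` separately: submodularity penalises positive correlation. -/
theorem le_bernoulliExp_add_charVec (hf : MonoSubmodular f) {z : N → ℝ} {β : ℝ}
    {S : Finset N} (hβ : β ∈ Set.Icc (0 : ℝ) 1) (hz : ∀ i, z i ∈ Set.Icc (0 : ℝ) 1)
    (hzS : ∀ i, (z + β • charVec S) i ∈ Set.Icc (0 : ℝ) 1) (s : Finset N) :
    (1 - β) * bernoulliExp z s f + β * bernoulliExp z s (fun A => f ((S ∩ s) ∪ A)) ≤
      bernoulliExp (z + β • charVec S) s f := by
  induction s using Finset.induction_on generalizing f with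
  | empty =>
    simp only [bernoulliExp_empty, Finset.inter_empty, Finset.empty_union]
    exact le_of_eq (by ring)
  | insert e s he ih =>
    have i0 := ih hf
    have i1 := ih (hf.insert_left e)
    simp only [bernoulliExp_insert _ he]
    by_cases h : e ∈ S
    · have e1 : ∀ A : Finset N, (S ∩ insert e s) ∪ A = insert e ((S ∩ s) ∪ A) := fun A => by
        rw [Finset.inter_insert_of_mem h, Finset.insert_union]
      have e2 : ∀ A : Finset N, insert e ((S ∩ s) ∪ insert e A) = insert e ((S ∩ s) ∪ A) :=
        fun A => by rw [Finset.union_insert, Finset.insert_idem]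
      simp only [e1, e2]
      have hw : (z + β • charVec S) e = z e + β := by simp [charVec, h]
      rw [hw]
      have hmono : bernoulliExp (z + β • charVec S) s f ≤
          bernoulliExp (z + β • charVec S) s (fun A => f (insert e A)) :=
        bernoulliExp_mono (fun i _ => hzS i) fun A => hf.mono (Finset.subset_insert e A)
      have hsub : bernoulliExp z s (fun A => f (insert e ((S ∩ s) ∪ A))) + bernoulliExp z s f ≤
          bernoulliExp z s (fun A => f ((S ∩ s) ∪ A)) +
            bernoulliExp z s (fun A => f (insert e A)) := by
        rw [← bernoulliExp_add, ← bernoulliExp_add]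
        refine bernoulliExp_mono (fun i _ => hz i) fun A => ?_
        have := hf.submod A (S ∩ s) {e}
        rwa [Finset.union_comm _ {e}, ← Finset.insert_eq, Finset.union_comm A {e},
          ← Finset.insert_eq, Finset.union_comm A] at this
      obtain ⟨hz0, hz1⟩ := hz e
      obtain ⟨hβ0, hβ1⟩ := hβ
      generalize bernoulliExp (z + β • charVec S) s f = W0 at *
      generalize bernoulliExp (z + β • charVec S) s (fun A => f (insert e A)) = W1 at *
      generalize bernoulliExp z s (fun A => f (insert e ((S ∩ s) ∪ A))) = G1 at *
      generalize bernoulliExp z s (fun A => f ((S ∩ s) ∪ A)) = G0 at *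
      generalize bernoulliExp z s (fun A => f (insert e A)) = F1 at *
      generalize bernoulliExp z s f = F0 at *
      have i1' : (1 - β) * F1 + β * G1 ≤ W1 := by
        simpa only using i1
      -- `(1 - z e) * (1 - β)` is the probability that `e` is missed by two independent coins of
      -- bias `z e` and `β`. Weighting `i0` and `i1'` by it and its complement treats `e` as present
      -- with probability `z e + β - z e * β`; `k3` pays for the missing `z e * β` by monotonicity,
      -- and `k4` is the submodular exchange.
      have ha0 : 0 ≤ (1 - z e) * (1 - β) := mul_nonneg (by linarith) (by linarith)
      have ha1 : 0 ≤ 1 - (1 - z e) * (1 - β) := by nlinarith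
      have k1 := mul_le_mul_of_nonneg_left i0 ha0
      have k2 := mul_le_mul_of_nonneg_left i1' ha1
      have k3 : 0 ≤ z e * β * (W1 - W0) := mul_nonneg (mul_nonneg hz0 hβ0) (by linarith)
      have k4 := mul_le_mul_of_nonneg_left hsub (mul_nonneg hβ0 ha0)
      linarith
    · have e1 : S ∩ insert e s = S ∩ s := Finset.inter_insert_of_notMem h
      have hw : (z + β • charVec S) e = z e := by simp [charVec, h]
      have e2 : ∀ A : Finset N, (S ∩ s) ∪ insert e A = insert e ((S ∩ s) ∪ A) := fun A =>
        Finset.union_insert _ _ _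
      simp only [e1, hw, e2]
      obtain ⟨hz0, hz1⟩ := hz e
      have k0 := mul_le_mul_of_nonneg_left i0 (sub_nonneg.2 hz1)
      have k1 := mul_le_mul_of_nonneg_left i1 hz0
      linarith

/-- Choosing the members of a family of sets independently yields at most the expected value
obtained by choosing the elements independently with the added-up probabilities. -/
theorem bernoulliExp_biUnion_le [Fintype N] (hf : MonoSubmodular f) {β : Finset N → ℝ}
    (hβ : ∀ S, 0 ≤ β S) (U : Finset (Finset N)) (hU : ∑ S ∈ U, β S ≤ 1) :
    bernoulliExp β U (fun T => f (T.biUnion id)) ≤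
      bernoulliExp (∑ S ∈ U, β S • charVec S) Finset.univ f := by
  have cube : ∀ V : Finset (Finset N), ∑ S ∈ V, β S ≤ 1 → ∀ i,
      (∑ S ∈ V, β S • charVec S) i ∈ Set.Icc (0 : ℝ) 1 := by
    intro V hV i
    simp only [Finset.sum_apply, Pi.smul_apply, smul_eq_mul, charVec, mul_ite, mul_one, mul_zero]
    refine ⟨Finset.sum_nonneg fun S _ => ?_, le_trans (Finset.sum_le_sum fun S _ => ?_) hV⟩ <;>
      split_ifs <;> simp [hβ S]
  induction U using Finset.induction_on generalizing f with
  | empty =>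
    simp only [bernoulliExp_empty, Finset.biUnion_empty]
    rw [← bernoulliExp_const (∑ S ∈ (∅ : Finset (Finset N)), β S • charVec S) Finset.univ (f ∅)]
    exact bernoulliExp_mono (fun i _ => cube ∅ (by simp) i) fun A => hf.mono (by simp)
  | insert S U hS ih =>
    rw [Finset.sum_insert hS] at hU
    have hU' : ∑ S ∈ U, β S ≤ 1 := by linarith [hβ S]
    have hS1 : β S ≤ 1 := by linarith [Finset.sum_nonneg fun T (_ : T ∈ U) => hβ T]
    have c := cube (insert S U) (by rwa [Finset.sum_insert hS])
    rw [Finset.sum_insert hS, add_comm] at c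
    rw [bernoulliExp_insert _ hS, Finset.sum_insert hS, add_comm (β S • charVec S)]
    simp only [Finset.biUnion_insert, id]
    refine le_trans (add_le_add (mul_le_mul_of_nonneg_left (ih hf hU') (by linarith))
      (mul_le_mul_of_nonneg_left (ih (hf.union_left S) hU') (hβ S))) ?_
    simpa using hf.le_bernoulliExp_add_charVec ⟨hβ S, hS1⟩ (cube U hU') c Finset.univ

end MonoSubmodular

/-! ### Layer decomposition and the correlation gap. -/

/-- Every nonnegative function on a finite type is a nonnegative combination of indicators of a
chain of sets. -/
theorem layer_induction {ι : Type*} [Fintype ι] [DecidableEq ι] {P : (ι → ℝ) → Prop}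
    (zero : P 0)
    (add : ∀ (J : Finset ι) (μ : ℝ) (w : ι → ℝ), 0 < μ → (∀ i, 0 ≤ w i) →
      (∀ i ∉ J, w i = 0) → P w → P (w + μ • charVec J))
    (w : ι → ℝ) (hw : ∀ i, 0 ≤ w i) : P w := by
  induction hn : (Finset.univ.filter fun i => w i ≠ 0).card using Nat.strong_induction_on
    generalizing w with
  | _ n ih =>
    subst hn
    set J := Finset.univ.filter fun i => w i ≠ 0 with hJ
    rcases J.eq_empty_or_nonempty with h | h
    · have : w = 0 := by
        funext i
        by_contra hi
        have : i ∈ J := by simpa [hJ] using hi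
        simp [h] at this
      exact this ▸ zero
    -- Subtracting the least positive value on the whole support `J` removes `k` from the support
    -- and keeps the rest nonnegative, so the layers are nested.
    · obtain ⟨k, hk, hmin⟩ := J.exists_min_image w h
      have hkpos : 0 < w k := lt_of_le_of_ne (hw k) (Ne.symm (by simpa [hJ] using hk))
      have hJ0 : ∀ i ∉ J, w i = 0 := fun i hi => by simpa [hJ] using hi
      set w' : ι → ℝ := w - w k • charVec J with hw'
      have h0 : ∀ i ∉ J, w' i = 0 := fun i hi => by simp [hw', charVec, hi, hJ0 i hi]
      have hw0 : ∀ i, 0 ≤ w' i := fun i => by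
        by_cases hi : i ∈ J
        · simpa [hw', charVec, hi] using hmin i hi
        · exact (h0 i hi).ge
      have hlt : (Finset.univ.filter fun i => w' i ≠ 0).card < J.card := by
        refine Finset.card_lt_card (Finset.ssubset_iff_of_subset ?_ |>.2 ⟨k, hk, ?_⟩)
        · intro i hi
          by_contra hiJ
          exact (Finset.mem_filter.1 hi).2 (h0 i hiJ)
        · simp [hw', charVec, hk]
      have := add J (w k) w' hkpos hw0 h0 (ih _ hlt w' hw0 rfl)
      rwa [hw', sub_add_cancel] at this

theorem prod_le_arith_mean_pow {ι : Type*} (s : Finset ι) (z : ι → ℝ) (hs : s.Nonempty)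
    (hz : ∀ i ∈ s, 0 ≤ z i) : ∏ i ∈ s, z i ≤ ((∑ i ∈ s, z i) / s.card) ^ s.card := by
  have hc : (0 : ℝ) < s.card := by exact_mod_cast hs.card_pos
  have h := Real.geom_mean_le_arith_mean s (fun _ => 1) z (by simp) (by simpa using hc) hz
  simp only [Real.rpow_one, Finset.sum_const, nsmul_eq_mul, mul_one, one_mul] at h
  have h0 := Finset.prod_nonneg hz
  have := pow_le_pow_left₀ (Real.rpow_nonneg h0 _) h s.card
  rwa [Real.rpow_inv_natCast_pow h0 hs.card_pos.ne'] at this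

/-- Padding the product with ones to `U.card` factors, AM-GM bounds it by `(1 - b a / U.card) ^
U.card`, where `a` is the mass of `J`. The base is the convex combination of `1` and `1 - b /
U.card` with weights `1 - a` and `a`, so convexity of the power finishes. -/
theorem mul_sum_le_one_sub_prod {ι : Type*} [DecidableEq ι] {U J : Finset ι} (hJ : J ⊆ U)
    {α : ι → ℝ} (hα : ∀ i, 0 ≤ α i) (hsum : ∑ i ∈ U, α i ≤ 1) {b : ℝ} (hb0 : 0 ≤ b)
    (hb1 : b ≤ 1) :
    (1 - (1 - b / U.card) ^ U.card) * ∑ i ∈ J, α i ≤ 1 - ∏ i ∈ J, (1 - b * α i) := by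
  rcases U.eq_empty_or_nonempty with rfl | hU
  · simp [Finset.subset_empty.1 hJ]
  have hn : (1 : ℝ) ≤ U.card := by exact_mod_cast hU.card_pos
  have hα1 : ∀ i ∈ U, α i ≤ 1 := fun i hi =>
    (Finset.single_le_sum (fun j _ => hα j) hi).trans hsum
  set a := ∑ i ∈ J, α i with ha
  have ha0 : 0 ≤ a := Finset.sum_nonneg fun i _ => hα i
  have ha1 : a ≤ 1 := (Finset.sum_le_sum_of_subset_of_nonneg hJ fun i _ _ => hα i).trans hsum
  have h1 : ∏ i ∈ J, (1 - b * α i) ≤ (1 - b * a / U.card) ^ U.card := by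
    have e1 : ∏ i ∈ J, (1 - b * α i) = ∏ i ∈ U, (1 - if i ∈ J then b * α i else 0) := by
      rw [← Finset.prod_subset hJ (fun i _ hi => by simp [hi])]
      exact Finset.prod_congr rfl fun i hi => by simp [hi]
    have e2 : (∑ i ∈ U, (1 - if i ∈ J then b * α i else 0)) / U.card = 1 - b * a / U.card := by
      rw [Finset.sum_sub_distrib, ← Finset.sum_filter, Finset.filter_mem_eq_inter,
        Finset.inter_eq_right.2 hJ, ← Finset.mul_sum, ← ha]
      simp only [Finset.sum_const, nsmul_eq_mul, mul_one]
      field_simp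
    rw [e1, ← e2]
    refine prod_le_arith_mean_pow U _ hU fun i hi => ?_
    split_ifs
    · nlinarith [hα1 i hi, hα i]
    · simp
  have h2 : (1 - b * a / U.card) ^ U.card ≤ (1 - a) + a * (1 - b / U.card) ^ U.card := by
    have hb : 0 ≤ 1 - b / (U.card : ℝ) := by
      rw [sub_nonneg, div_le_one (by linarith)]
      linarith
    have := (convexOn_pow (𝕜 := ℝ) U.card).2 (Set.mem_Ici.2 zero_le_one) (Set.mem_Ici.2 hb)
      (sub_nonneg.2 ha1) ha0 (by ring)
    simp only [smul_eq_mul, mul_one, one_pow] at this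
    rwa [show 1 - b * a / (U.card : ℝ) = 1 - a + a * (1 - b / U.card) by ring]
  linarith

/-- Here `m T` plays the role of the largest weight in `T`, or `0` if `T` is empty. Over nested
layers that maximum is the sum of the `μ` whose layer `T` hits, so the hitting estimate applies to
each layer. -/
theorem exists_le_weight_and_mul_sum_le {ι : Type*} [Fintype ι] [DecidableEq ι] {U : Finset ι}
    {α : ι → ℝ} (hα : ∀ i, 0 ≤ α i) (hsum : ∑ i ∈ U, α i ≤ 1) {b : ℝ} (hb0 : 0 ≤ b)
    (hb1 : b ≤ 1) (w : ι → ℝ) (hw : ∀ i, 0 ≤ w i) :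
    ∃ m : Finset ι → ℝ, (∀ T, m T ≤ 0 ∨ ∃ j ∈ T, m T ≤ w j) ∧
      (1 - (1 - b / U.card) ^ U.card) * ∑ i ∈ U, α i * w i ≤
        bernoulliExp (fun i => b * α i) U m := by
  refine layer_induction (P := fun w => ∃ m : Finset ι → ℝ,
    (∀ T, m T ≤ 0 ∨ ∃ j ∈ T, m T ≤ w j) ∧ (1 - (1 - b / U.card) ^ U.card) * ∑ i ∈ U, α i * w i ≤
      bernoulliExp (fun i => b * α i) U m) ?_ ?_ w hw
  · exact ⟨fun _ => 0, fun _ => Or.inl le_rfl, by simp [bernoulliExp_const]⟩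
  · rintro J μ w hμ hw0 hwJ ⟨m, hm, hle⟩
    refine ⟨fun T => m T + μ * (if Disjoint T J then 0 else 1), fun T => ?_, ?_⟩
    · by_cases hT : Disjoint T J
      · left
        rcases hm T with h | ⟨j, hj, h⟩
        · simpa [hT] using h
        · simpa [hT, hwJ j (Finset.disjoint_left.1 hT hj)] using h
      · right
        obtain ⟨k, hkT, hkJ⟩ := Finset.not_disjoint_iff.1 hT
        -- Any element of `T ∩ J` is a witness once `m T ≤ 0`; a previous witness outside `J` has
        -- weight `0` and falls under this case.
        have key : m T ≤ 0 → ∃ j ∈ T, m T + μ * (if Disjoint T J then 0 else 1) ≤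
            (w + μ • charVec J) j := fun h =>
          ⟨k, hkT, by simpa [hT, charVec, hkJ] using h.trans (hw0 k)⟩
        rcases hm T with h | ⟨j, hj, h⟩
        · exact key h
        · by_cases hjJ : j ∈ J
          · exact ⟨j, hj, by simpa [hT, charVec, hjJ] using h⟩
          · exact key (h.trans (hwJ j hjJ).le)
    · rw [bernoulliExp_add, bernoulliExp_smul, bernoulliExp_hit]
      have h := mul_le_mul_of_nonneg_left
        (mul_sum_le_one_sub_prod (Finset.inter_subset_left (s₁ := U) (s₂ := J)) hα hsum hb0 hb1)
        hμ.le
      have e : ∑ i ∈ U, α i * (w + μ • charVec J) i =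
          ∑ i ∈ U, α i * w i + μ * ∑ i ∈ U ∩ J, α i := by
        rw [← Finset.filter_mem_eq_inter, Finset.sum_filter, Finset.mul_sum,
          ← Finset.sum_add_distrib]
        refine Finset.sum_congr rfl fun i _ => ?_
        by_cases hi : i ∈ J <;> simp [charVec, hi] ; ring
      rw [e]
      linarith

/-- The correlation gap of a monotone submodular function with respect to a combination of
characteristic vectors. -/
theorem MonoSubmodular.correlation_gap {N : Type*} [Fintype N] [DecidableEq N]
    {f : Finset N → ℝ} (hf : MonoSubmodular f) (h0 : 0 ≤ f ∅) {α : Finset N → ℝ}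
    (hα : ∀ S, 0 ≤ α S) {U : Finset (Finset N)} (hU : ∑ S ∈ U, α S ≤ 1) {b : ℝ} (hb0 : 0 ≤ b)
    (hb1 : b ≤ 1) :
    (1 - (1 - b / U.card) ^ U.card) * ∑ S ∈ U, α S * f S ≤
      bernoulliExp (b • ∑ S ∈ U, α S • charVec S) Finset.univ f := by
  have hf0 : ∀ S, 0 ≤ f S := fun S => h0.trans (hf.mono (Finset.empty_subset S))
  obtain ⟨m, hm, hle⟩ := exists_le_weight_and_mul_sum_le hα hU hb0 hb1 f hf0
  have hα1 : ∀ i ∈ U, α i ≤ 1 := fun i hi =>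
    (Finset.single_le_sum (fun j _ => hα j) hi).trans hU
  have hβ : ∑ S ∈ U, b * α S ≤ 1 := by
    rw [← Finset.mul_sum]
    exact mul_le_one₀ hb1 (Finset.sum_nonneg fun S _ => hα S) hU
  have h := hf.bernoulliExp_biUnion_le (fun S => mul_nonneg hb0 (hα S)) U hβ
  simp only [mul_smul] at h
  rw [← Finset.smul_sum] at h
  refine hle.trans (le_trans (bernoulliExp_mono (fun i hi => ?_) fun T => ?_) h)
  · exact ⟨mul_nonneg hb0 (hα i), mul_le_one₀ hb1 (hα i) (hα1 i hi)⟩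
  · rcases hm T with h | ⟨j, hj, h⟩
    · exact h.trans (hf0 _)
    · exact h.trans (hf.mono (Finset.subset_biUnion_of_mem id hj))

/-! ### Convex and conic decompositions of points of the polytope. -/

theorem exists_weights_of_mem_feasiblePolytope {N : Type*} [Fintype N] [DecidableEq N]
    {I : Set (Finset N)} {p : N → ℝ} (hp : p ∈ feasiblePolytope I) :
    ∃ α : Finset N → ℝ, (∀ S, 0 ≤ α S) ∧ (∀ S, α S ≠ 0 → S ∈ I) ∧ ∑ S, α S = 1 ∧
      p = ∑ S, α S • charVec S := by
  suffices h : feasiblePolytope I ⊆ {p | ∃ α : Finset N → ℝ, (∀ S, 0 ≤ α S) ∧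
      (∀ S, α S ≠ 0 → S ∈ I) ∧ ∑ S, α S = 1 ∧ p = ∑ S, α S • charVec S} from h hp
  refine convexHull_min ?_ ?_
  · rintro _ ⟨S, hS, rfl⟩
    refine ⟨Pi.single S 1, fun T => ?_, fun T hT => ?_, ?_, ?_⟩
    · by_cases h : T = S <;> simp [h]
    · by_cases h : T = S
      · exact h ▸ hS
      · simp [h] at hT
    · simp
    · simp [Pi.single_apply]
  · rintro _ ⟨α, hα, hαI, hα1, rfl⟩ _ ⟨β, hβ, hβI, hβ1, rfl⟩ s t hs ht hst
    refine ⟨s • α + t • β, fun S => ?_, fun S hS => ?_, ?_, ?_⟩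
    · exact add_nonneg (mul_nonneg hs (hα S)) (mul_nonneg ht (hβ S))
    · by_contra h
      have h1 : α S = 0 := by_contra fun h' => h (hαI S h')
      have h2 : β S = 0 := by_contra fun h' => h (hβI S h')
      simp [h1, h2] at hS
    · simp [Finset.sum_add_distrib, ← Finset.mul_sum, hα1, hβ1, hst]
    · simp [Finset.smul_sum, add_smul, Finset.sum_add_distrib, mul_smul]

/-- A conic Carathéodory theorem: the combination can be supported on at most `dim` vectors
without increasing the sum of its coefficients. -/
theorem exists_conic_combination_card_le {ι E : Type*} [Fintype ι] [DecidableEq ι]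
    [AddCommGroup E] [Module ℝ E] [Module.Finite ℝ E] (v : ι → E) (α : ι → ℝ)
    (hα : ∀ i, 0 ≤ α i) :
    ∃ β : ι → ℝ, (∀ i, 0 ≤ β i) ∧ (∀ i, β i ≠ 0 → α i ≠ 0) ∧ ∑ i, β i ≤ ∑ i, α i ∧
      ∑ i, β i • v i = ∑ i, α i • v i ∧
      (Finset.univ.filter fun i => β i ≠ 0).card ≤ Module.finrank ℝ E := by
  induction hn : (Finset.univ.filter fun i => α i ≠ 0).card using Nat.strong_induction_on
    generalizing α with
  | _ n ih =>
    subst hn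
    set J := Finset.univ.filter fun i => α i ≠ 0 with hJ
    by_cases hc : J.card ≤ Module.finrank ℝ E
    · exact ⟨α, hα, fun _ => id, le_rfl, rfl, hc⟩
    have hJmem : ∀ i, i ∈ J ↔ α i ≠ 0 := fun i => by simp [hJ]
    have hdep : ∃ g : ι → ℝ, (∀ i ∉ J, g i = 0) ∧ ∑ i, g i • v i = 0 ∧ g ≠ 0 := by
      have hli : ¬ LinearIndependent ℝ (fun i : J => v i) := fun h => by
        have := h.fintype_card_le_finrank
        rw [Fintype.card_coe] at this
        exact hc this
      obtain ⟨g, hg, k, hk⟩ := Fintype.not_linearIndependent_iff.1 hli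
      refine ⟨fun i => if h : i ∈ J then g ⟨i, h⟩ else 0, fun i hi => by simp [hi], ?_, ?_⟩
      · rw [← hg, ← Finset.sum_subset J.subset_univ (fun i _ hi => by simp [hi]),
          ← Finset.sum_coe_sort]
        exact Finset.sum_congr rfl fun i _ => by simp
      · intro h
        have := congrFun h k
        simp at this
        exact hk this
    -- Choosing the sign so that `∑ g ≥ 0` ensures that subtracting a multiple of `g` does not raise
    -- the coefficient sum, and that `g` has a positive entry.
    obtain ⟨g, hgJ, hgv, hg0, hgs⟩ : ∃ g : ι → ℝ, (∀ i ∉ J, g i = 0) ∧ ∑ i, g i • v i = 0 ∧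
        g ≠ 0 ∧ 0 ≤ ∑ i, g i := by
      obtain ⟨g, h1, h2, h3⟩ := hdep
      rcases le_total 0 (∑ i, g i) with h | h
      · exact ⟨g, h1, h2, h3, h⟩
      · exact ⟨-g, fun i hi => by simp [h1 i hi], by simp [h2], neg_ne_zero.2 h3, by simpa using h⟩
    have hpos : (Finset.univ.filter fun i => 0 < g i).Nonempty := by
      by_contra hne
      have hle : ∀ i, g i ≤ 0 := fun i => by
        by_contra hi
        exact hne ⟨i, by simpa using hi⟩
      have hz : ∑ i, g i = 0 := le_antisymm (Finset.sum_nonpos fun i _ => hle i) hgs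
      refine hg0 (funext fun i => ?_)
      exact (Finset.sum_eq_zero_iff_of_nonpos fun i _ => hle i).1 hz i (Finset.mem_univ i)
    obtain ⟨k, hk, hmin⟩ := Finset.exists_min_image _ (fun i => α i / g i) hpos
    replace hk : 0 < g k := by simpa using hk
    -- The largest step keeping all coefficients nonnegative; it annihilates coefficient `k`.
    set t := α k / g k with ht
    have ht0 : 0 ≤ t := div_nonneg (hα k) hk.le
    have hkJ : k ∈ J := by
      by_contra h
      exact hk.ne' (hgJ k h)
    have hα' : ∀ i, 0 ≤ (α - t • g) i := fun i => by
      simp only [Pi.sub_apply, Pi.smul_apply, smul_eq_mul, sub_nonneg]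
      rcases le_or_gt (g i) 0 with h | h
      · exact (mul_nonpos_of_nonneg_of_nonpos ht0 h).trans (hα i)
      · exact (le_div_iff₀ h).1 (hmin i (by simpa using h))
    have hsupp : ∀ i, (α - t • g) i ≠ 0 → α i ≠ 0 := fun i hi h => hi (by
      simp [h, hgJ i (fun h' => (hJmem i).1 h' h)])
    have hlt : (Finset.univ.filter fun i => (α - t • g) i ≠ 0).card < J.card := by
      refine Finset.card_lt_card ((Finset.ssubset_iff_of_subset fun i hi => ?_).2 ⟨k, hkJ, ?_⟩)
      · exact (hJmem i).2 (hsupp i (Finset.mem_filter.1 hi).2)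
      · simp [ht, hk.ne']
    obtain ⟨β, h1, h2, h3, h4, h5⟩ := ih _ hlt (α - t • g) hα' rfl
    refine ⟨β, h1, fun i hi => hsupp i (h2 i hi), h3.trans ?_, h4.trans ?_, h5⟩
    · simp only [Pi.sub_apply, Pi.smul_apply, smul_eq_mul, Finset.sum_sub_distrib,
        ← Finset.mul_sum]
      linarith [mul_nonneg ht0 hgs]
    · simp [sub_smul, mul_smul, Finset.sum_sub_distrib, ← Finset.smul_sum, hgv]

/-! ### Matroid rank and weighted rank. -/

theorem charVec_dot {N : Type*} [Fintype N] [DecidableEq N] (y : N → ℝ) (S : Finset N) :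
    ∑ i, y i * charVec S i = ∑ i ∈ S, y i := by
  simp [charVec]

/-- The rank of a finite set, as a real number. -/
noncomputable def Matroid.realRk {N : Type*} (M : Matroid N) (A : Finset N) : ℝ :=
  ((M.eRk (A : Set N)).toNat : ℝ)

section RealRk

variable {N : Type*} (M : Matroid N)

theorem Matroid.eRk_coe_ne_top (A : Finset N) : M.eRk (A : Set N) ≠ ⊤ :=
  ((M.eRk_le_encard _).trans_lt (by simp)).ne

theorem Matroid.realRk_mono {A B : Finset N} (h : A ⊆ B) : M.realRk A ≤ M.realRk B :=
  Nat.cast_le.2 <| ENat.toNat_le_toNat (M.eRk_mono (Finset.coe_subset.2 h)) (M.eRk_coe_ne_top B)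

theorem Matroid.realRk_submod [DecidableEq N] (A B : Finset N) :
    M.realRk (A ∩ B) + M.realRk (A ∪ B) ≤ M.realRk A + M.realRk B := by
  have h := M.eRk_submod (A : Set N) (B : Set N)
  rw [← Finset.coe_inter, ← Finset.coe_union] at h
  have h' := ENat.toNat_le_toNat h (by simp [M.eRk_coe_ne_top])
  rw [ENat.toNat_add (M.eRk_coe_ne_top _) (M.eRk_coe_ne_top _),
    ENat.toNat_add (M.eRk_coe_ne_top _) (M.eRk_coe_ne_top _)] at h'
  simp only [Matroid.realRk]
  exact_mod_cast h'

theorem Matroid.monoSubmodular_realRk [DecidableEq N] : MonoSubmodular M.realRk where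
  mono _ _ h := M.realRk_mono h
  submod A B C := by
    have h := M.realRk_submod (A ∪ B) (A ∪ C)
    have h1 : M.realRk A ≤ M.realRk ((A ∪ B) ∩ (A ∪ C)) :=
      M.realRk_mono (Finset.subset_inter Finset.subset_union_left Finset.subset_union_left)
    rw [← Finset.union_union_distrib_left, ← Finset.union_assoc] at h
    linarith

theorem Matroid.realRk_indep {S : Finset N} (hS : M.Indep (S : Set N)) : M.realRk S = S.card := by
  rw [Matroid.realRk, hS.eRk_eq_encard, Set.encard_coe_eq_coe_finsetCard, ENat.toNat_natCast]

theorem Matroid.exists_indep_extension {S A : Finset N} (hS : M.Indep (S : Set N)) (hSA : S ⊆ A) :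
    ∃ B : Finset N, M.Indep (B : Set N) ∧ S ⊆ B ∧ B ⊆ A ∧ M.realRk A = B.card := by
  obtain ⟨B, hB, hSB⟩ := hS.subset_isBasis'_of_subset (Finset.coe_subset.2 hSA)
  lift B to Finset N using A.finite_toSet.subset hB.subset
  refine ⟨B, hB.indep, Finset.coe_subset.1 hSB, Finset.coe_subset.1 hB.subset, ?_⟩
  rw [Matroid.realRk, hB.eRk_eq_encard, Set.encard_coe_eq_coe_finsetCard, ENat.toNat_natCast]

end RealRk

namespace MonoSubmodular

variable {N : Type*} [DecidableEq N] {f g : Finset N → ℝ}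

theorem add_smul_inter (hf : MonoSubmodular f) (hg : MonoSubmodular g) {μ : ℝ} (hμ : 0 ≤ μ)
    (J : Finset N) : MonoSubmodular (fun A => f A + μ * g (A ∩ J)) where
  mono _ _ h := add_le_add (hf.mono h)
    (mul_le_mul_of_nonneg_left (hg.mono (Finset.inter_subset_inter_right h)) hμ)
  submod A B C := by
    have h1 := hf.submod A B C
    have h2 := mul_le_mul_of_nonneg_left (hg.submod (A ∩ J) (B ∩ J) (C ∩ J)) hμ
    simp only [← Finset.union_inter_distrib_right] at h2
    linarith

end MonoSubmodular

/-- The greedy algorithm: the weighted rank function of a matroid is monotone submodular. -/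
theorem Matroid.exists_weighted_rank {N : Type*} [Fintype N] [DecidableEq N] (M : Matroid N)
    (y : N → ℝ) (hy : ∀ i, 0 ≤ y i) :
    ∃ f : Finset N → ℝ, MonoSubmodular f ∧ 0 ≤ f ∅ ∧
      (∀ S ∈ indepSets M, ∑ i ∈ S, y i ≤ f S) ∧
      ∀ A, ∃ S ∈ indepSets M, S ⊆ A ∧ (∀ i ∈ S, 0 < y i) ∧ f A ≤ ∑ i ∈ S, y i := by
  refine layer_induction (P := fun y => ∃ f : Finset N → ℝ, MonoSubmodular f ∧ 0 ≤ f ∅ ∧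
      (∀ S ∈ indepSets M, ∑ i ∈ S, y i ≤ f S) ∧
      ∀ A, ∃ S ∈ indepSets M, S ⊆ A ∧ (∀ i ∈ S, 0 < y i) ∧ f A ≤ ∑ i ∈ S, y i) ?_ ?_ y hy
  · refine ⟨fun _ => 0, ⟨fun _ _ _ => le_rfl, fun _ _ _ => le_rfl⟩, le_rfl, by simp, fun A => ?_⟩
    exact ⟨∅, by simp [indepSets], by simp, by simp, by simp⟩
  · rintro J μ y hμ hy hyJ ⟨f, hf, hf0, hfI, hfA⟩
    have hsum : ∀ S : Finset N, ∑ i ∈ S, (y + μ • charVec J) i =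
        ∑ i ∈ S, y i + μ * (S ∩ J).card := fun S => by
      simp only [Pi.add_apply, Pi.smul_apply, smul_eq_mul, Finset.sum_add_distrib,
        ← Finset.mul_sum]
      congr 2
      simp [charVec]
    -- The weighted rank is the sum over layers of `μ` times the rank of `A ∩ J`.
    refine ⟨fun A => f A + μ * M.realRk (A ∩ J), hf.add_smul_inter M.monoSubmodular_realRk hμ.le J,
      add_nonneg hf0 (mul_nonneg hμ.le (Nat.cast_nonneg _)), fun S hS => ?_, fun A => ?_⟩
    · have hSJ : M.Indep ((S ∩ J : Finset N) : Set N) :=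
        Matroid.Indep.subset hS (Finset.coe_subset.2 Finset.inter_subset_left)
      rw [hsum]
      beta_reduce
      rw [M.realRk_indep hSJ]
      exact add_le_add_left (hfI S hS) _
    · obtain ⟨S, hS, hSA, hSy, hle⟩ := hfA A
      -- Positivity of `y` on `S` puts the set chosen from the heavier layers inside `J`; greedy
      -- then extends it to a basis of `A ∩ J`.
      have hSJ : S ⊆ A ∩ J := fun i hi => Finset.mem_inter.2 ⟨hSA hi, by
        by_contra h
        exact (hSy i hi).ne' (hyJ i h)⟩
      obtain ⟨B, hB, hSB, hBA, hcard⟩ := M.exists_indep_extension hS hSJ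
      have hBJ : B ⊆ J := hBA.trans Finset.inter_subset_right
      refine ⟨B, hB, hBA.trans Finset.inter_subset_left, fun i hi => ?_, ?_⟩
      · have := hy i
        simp only [Pi.add_apply, Pi.smul_apply, charVec, hBJ hi, if_true, smul_eq_mul, mul_one]
        linarith
      · rw [hsum]
        beta_reduce
        rw [hcard, Finset.inter_eq_left.2 hBJ]
        exact add_le_add_left (hle.trans
          (Finset.sum_le_sum_of_subset_of_nonneg hSB fun i _ _ => hy i)) _

/-! ### From the correlation gap to marginals, by separation. -/

/-- The correlation gap of weighted matroid rank functions. -/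
theorem Matroid.le_sum_independentMass_mul {N : Type*} [Fintype N] [DecidableEq N]
    (M : Matroid N) {b : ℝ} (hb0 : 0 ≤ b) (hb1 : b ≤ 1) {p : N → ℝ}
    (hp : p ∈ feasiblePolytope (indepSets M)) {y : N → ℝ}
    {f : Finset N → ℝ} (hf : MonoSubmodular f) (hf0 : 0 ≤ f ∅)
    (hfI : ∀ S ∈ indepSets M, ∑ i ∈ S, y i ≤ f S) :
    (1 - (1 - b / (Fintype.card N : ℝ)) ^ Fintype.card N) * ∑ i, y i * p i ≤
      ∑ A, independentMass (b • p) A * f A := by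
  obtain ⟨α, hα, hαI, hα1, rfl⟩ := exists_weights_of_mem_feasiblePolytope hp
  obtain ⟨β, hβ, hβα, hβ1, hβv, hcard⟩ := exists_conic_combination_card_le charVec α hα
  rw [Module.finrank_fintype_fun_eq_card] at hcard
  -- Padding with sets of coefficient `0` to exactly `n` sets (there are `2^n ≥ n`) gives exponent
  -- `n` without comparing the bound at different exponents.
  obtain ⟨U, hU, hUcard⟩ := Finset.exists_superset_card_eq hcard (by
    rw [Fintype.card_finset]; exact Nat.lt_two_pow_self.le)
  have hβU : ∀ S ∉ U, β S = 0 := fun S hS => by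
    by_contra h
    exact hS (hU (by simpa using h))
  have hs : ∑ S ∈ U, β S ≤ 1 := by
    rw [← hα1]
    refine le_trans (le_of_eq ?_) hβ1
    exact Finset.sum_subset U.subset_univ fun S _ hS => hβU S hS
  have hv : ∑ S ∈ U, β S • charVec S = ∑ S, α S • charVec S := by
    rw [← hβv]
    exact Finset.sum_subset U.subset_univ fun S _ hS => by simp [hβU S hS]
  have h := hf.correlation_gap hf0 hβ hs hb0 hb1
  rw [hv, hUcard, ← sum_independentMass_mul] at h
  refine le_trans (mul_le_mul_of_nonneg_left ?_ ?_) h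
  · rw [← hv]
    simp only [Finset.sum_apply, Pi.smul_apply, smul_eq_mul, Finset.mul_sum]
    rw [Finset.sum_comm]
    refine Finset.sum_le_sum fun S _ => ?_
    by_cases h0 : β S = 0
    · simp [h0]
    · have : ∑ i, y i * (β S * charVec S i) = β S * ∑ i ∈ S, y i := by
        rw [← charVec_dot y S, Finset.mul_sum]
        exact Finset.sum_congr rfl fun i _ => by ring
      rw [this]
      exact mul_le_mul_of_nonneg_left (hfI S (hαI S (hβα S h0))) (hβ S)
  · rw [sub_nonneg]
    rcases (Fintype.card N).eq_zero_or_pos with h0 | h0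
    · simp [h0]
    · have h1 : (1 : ℝ) ≤ Fintype.card N := by exact_mod_cast h0
      refine pow_le_one₀ ?_ ?_
      · rw [sub_nonneg, div_le_one (by linarith)]
        linarith
      · linarith [div_nonneg hb0 (zero_le_one.trans h1)]

/-- A pointwise domination statement obtained by separation from its weighted versions. -/
theorem exists_dominating_selection {N : Type*} [Fintype N] [DecidableEq N]
    {κ : Type*} [Fintype κ] (m : κ → ℝ) (C : κ → Set (N → ℝ))
    (hconv : ∀ k, Convex ℝ (C k)) (hcomp : ∀ k, IsCompact (C k)) (t : N → ℝ)
    (h : ∀ y : N → ℝ, (∀ i, 0 ≤ y i) → ∃ z : κ → N → ℝ, (∀ k, z k ∈ C k) ∧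
      ∑ i, y i * t i ≤ ∑ i, y i * ∑ k, m k * z k i) :
    ∃ z : κ → N → ℝ, (∀ k, z k ∈ C k) ∧ ∀ i, t i ≤ ∑ k, m k * z k i := by
  by_contra hne
  push Not at hne
  let L : (κ → N → ℝ) →L[ℝ] (N → ℝ) := ∑ k, m k • ContinuousLinearMap.proj k
  have hL : ∀ z i, L z i = ∑ k, m k * z k i := fun z i => by
    simp [L, Finset.sum_apply]
  set K := L '' Set.pi Set.univ C with hK
  have hKconv : Convex ℝ K :=
    (convex_pi fun k _ => hconv k).is_linear_image L.toLinearMap.isLinear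
  have hKcomp : IsCompact K := (isCompact_univ_pi hcomp).image L.continuous
  have hdisj : Disjoint K (Set.Ici t) := by
    rw [Set.disjoint_left]
    rintro _ ⟨z, hz, rfl⟩ hzt
    obtain ⟨i, hi⟩ := hne z fun k => hz k (Set.mem_univ k)
    exact absurd (hzt i) (by rw [hL]; exact not_le.2 hi)
  obtain ⟨φ, u, v, hu, huv, hv⟩ :=
    geometric_hahn_banach_compact_closed hKconv hKcomp (convex_Ici t) isClosed_Ici hdisj
  set y : N → ℝ := fun i => φ (Pi.single i 1) with hy
  have hφ : ∀ q, φ q = ∑ i, y i * q i := fun q => by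
    conv_lhs => rw [pi_eq_sum_univ' q]
    simp [map_sum, hy, mul_comm]
  have hy0 : ∀ i, 0 ≤ y i := fun i => by
    by_contra hi
    push Not at hi
    -- If `y i < 0`, moving this far from `t` in direction `i` stays in the orthant above `t` but
    -- lowers `φ` to exactly `v`, against the strict bound `hv`.
    have hs : 0 ≤ (φ t - v) / -y i :=
      div_nonneg (sub_nonneg.2 (hv t Set.self_mem_Ici).le) (by linarith)
    have := hv (t + ((φ t - v) / -y i) • Pi.single i 1) (by
      refine Set.mem_Ici.2 (le_add_of_nonneg_right (smul_nonneg hs ?_))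
      exact Pi.single_nonneg.2 zero_le_one)
    rw [map_add, map_smul, smul_eq_mul, show φ (Pi.single i 1) = y i from rfl] at this
    have e : (φ t - v) / -y i * y i = -(φ t - v) := by
      rw [div_mul_eq_mul_div, div_neg, mul_div_cancel_right₀ _ hi.ne]
    linarith
  obtain ⟨z, hz, hle⟩ := h y hy0
  have h1 := hu (L z) ⟨z, fun k _ => hz k, rfl⟩
  have h2 := hv t Set.self_mem_Ici
  rw [hφ] at h1 h2
  simp only [hL] at h1
  linarith

theorem isCompact_feasiblePolytope {N : Type*} [Fintype N] [DecidableEq N]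
    (I : Set (Finset N)) : IsCompact (feasiblePolytope I) :=
  ((Set.toFinite I).image charVec).isCompact_convexHull (𝕜 := ℝ)

/-- Marginals of a contention resolution scheme at a single point. -/
theorem Matroid.exists_marginals {N : Type*} [Fintype N] [DecidableEq N]
    (M : Matroid N) {b : ℝ} (hb0 : 0 < b) (hb1 : b ≤ 1) {x : N → ℝ}
    (hx : x ∈ b • feasiblePolytope (indepSets M)) :
    ∃ z : Finset N → N → ℝ,
      (∀ A, z A ∈ feasiblePolytope {S ∈ indepSets M | ∀ i ∈ S, i ∈ A ∧ 0 < x i}) ∧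
      ∀ i, (1 - (1 - b / (Fintype.card N : ℝ)) ^ Fintype.card N) / b * x i ≤
        ∑ A, independentMass x A * z A i := by
  have hx0 : ∀ i, 0 ≤ x i := fun i =>
    (smul_feasiblePolytope_mem_cube ⟨hb0.le, hb1⟩ hx i).1
  refine exists_dominating_selection (independentMass x) _ (fun A => convex_convexHull ℝ _)
    (fun A => isCompact_feasiblePolytope _) _ fun y hy => ?_
  -- Zeroing the weights off `support(x)` costs nothing, and forces the sets picked, whose elements
  -- have positive weight, into `support(x)`.
  set y' : N → ℝ := fun i => if 0 < x i then y i else 0 with hy'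
  have hy'0 : ∀ i, 0 ≤ y' i := fun i => by
    simp only [hy']
    split_ifs <;> simp [hy i]
  have hyx : ∀ i, y i * x i = y' i * x i := fun i => by
    simp only [hy']
    split_ifs with h
    · rfl
    · simp [le_antisymm (not_lt.1 h) (hx0 i)]
  obtain ⟨f, hf, hf0, hfI, hfA⟩ := M.exists_weighted_rank y' hy'0
  choose S hSI hSA hSy hSf using hfA
  have hSx : ∀ A, ∀ i ∈ S A, 0 < x i := fun A i hi => by
    by_contra h
    have := hSy A i hi
    simp [hy', h] at this
  refine ⟨fun A => charVec (S A), fun A => subset_convexHull ℝ _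
    ⟨S A, ⟨hSI A, fun i hi => ⟨hSA A hi, hSx A i hi⟩⟩, rfl⟩, ?_⟩
  have hrhs : ∑ i, y i * ∑ A, independentMass x A * charVec (S A) i =
      ∑ A, independentMass x A * ∑ i ∈ S A, y' i := by
    simp only [Finset.mul_sum]
    rw [Finset.sum_comm]
    refine Finset.sum_congr rfl fun A _ => ?_
    rw [← Finset.mul_sum, Finset.sum_congr rfl
      (g := fun i => if i ∈ S A then independentMass x A * y' i else 0)]
    · rw [← Finset.sum_filter, Finset.mul_sum]
      simp [← Finset.mul_sum]
    · intro i _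
      by_cases hi : i ∈ S A
      · simp [charVec, hi, hy', hSx A i hi, mul_comm]
      · simp [charVec, hi]
  obtain ⟨p, hp, rfl⟩ := hx
  rw [hrhs]
  refine le_trans (le_of_eq ?_) ((M.le_sum_independentMass_mul hb0.le hb1 hp hf hf0 hfI).trans
    (Finset.sum_le_sum fun A _ => mul_le_mul_of_nonneg_left (hSf A) (independentMass_nonneg
      (smul_feasiblePolytope_mem_cube ⟨hb0.le, hb1⟩ ⟨p, hp, rfl⟩) A)))
  rw [Finset.mul_sum]
  refine Finset.sum_congr rfl fun i _ => ?_
  have := hyx i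
  simp only [Pi.smul_apply, smul_eq_mul] at this ⊢
  have e : y i * p i = y' i * p i := by
    have : b * (y i * p i) = b * (y' i * p i) := by linarith
    exact mul_left_cancel₀ hb0.ne' this
  rw [← e]
  field_simp

/-! ### Probabilities under the joint law, and assembly of the scheme. -/

theorem probOf_eq_sum {Ω : Type*} [Fintype Ω] (p : PMF Ω) (s : Set Ω) [DecidablePred (· ∈ s)] :
    probOf p s = ∑ ω, (p ω).toReal * if ω ∈ s then 1 else 0 := by
  rw [probOf, PMF.toOuterMeasure_apply_fintype, ENNReal.toReal_sum fun ω _ => ?_]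
  · refine Finset.sum_congr rfl fun ω _ => ?_
    by_cases h : ω ∈ s <;> simp [h]
  · by_cases h : ω ∈ s <;> simp [h, p.apply_ne_top]

theorem probOf_univ {Ω : Type*} (p : PMF Ω) : probOf p Set.univ = 1 := by
  rw [probOf, (p.toOuterMeasure_apply_eq_one_iff Set.univ).2 (Set.subset_univ _),
    ENNReal.toReal_one]

theorem probOf_empty {Ω : Type*} (p : PMF Ω) : probOf p ∅ = 0 := by
  simp [probOf]

theorem probOf_jointLaw {N : Type*} [Fintype N] [DecidableEq N] (ρ : PMF (Finset N))
    (π : Finset N → PMF (Finset N)) (s : Set (Finset N × Finset N)) :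
    probOf (jointLaw ρ π) s = ∑ R, (ρ R).toReal * probOf (π R) {J | (R, J) ∈ s} := by
  have htop : ∀ R, (π R).toOuterMeasure {J | (R, J) ∈ s} ≠ ⊤ := fun R => by
    classical
    rw [PMF.toOuterMeasure_apply_fintype]
    refine ENNReal.sum_ne_top.2 fun J _ => ?_
    by_cases h : (R, J) ∈ s <;> simp [Set.indicator, h, (π R).apply_ne_top]
  rw [probOf, jointLaw, PMF.toOuterMeasure_bind_apply, tsum_fintype,
    ENNReal.toReal_sum fun R _ => ?_]
  · refine Finset.sum_congr rfl fun R _ => ?_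
    rw [PMF.toOuterMeasure_map_apply, ENNReal.toReal_mul]
    rfl
  · rw [PMF.toOuterMeasure_map_apply]
    exact ENNReal.mul_ne_top (ρ.apply_ne_top R) (htop R)

/-- A point of the polytope is the vector of marginals of a random feasible set. -/
theorem exists_pmf_of_mem_feasiblePolytope {N : Type*} [Fintype N] [DecidableEq N]
    {I : Set (Finset N)} {v : N → ℝ} (hv : v ∈ feasiblePolytope I) :
    ∃ q : PMF (Finset N), (∀ J ∈ q.support, J ∈ I) ∧ ∀ i, probOf q {J | i ∈ J} = v i := by
  obtain ⟨α, hα, hαI, hα1, rfl⟩ := exists_weights_of_mem_feasiblePolytope hv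
  refine ⟨PMF.ofFintype (fun S => ENNReal.ofReal (α S)) ?_, fun J hJ => hαI J ?_, fun i => ?_⟩
  · rw [← ENNReal.ofReal_sum_of_nonneg fun S _ => hα S, hα1, ENNReal.ofReal_one]
  · rintro h
    simp [h] at hJ
  · simp [probOf_eq_sum, charVec, hα]

/-- Since `π A ⊆ A`, intersecting with the event `i ∈ R` does not change the numerator; the
denominator is `Pr[i ∈ R] = x i`. -/
theorem condProbOf_jointLaw_randomSet {N : Type*} [Fintype N] [DecidableEq N] {x : N → ℝ}
    (hx : ∀ i, x i ∈ Set.Icc (0 : ℝ) 1) (π : Finset N → PMF (Finset N))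
    (hπ : ∀ A, ∀ J ∈ (π A).support, J ⊆ A) (i : N) :
    condProbOf (jointLaw (randomSet x hx) π) {ω | i ∈ ω.2} {ω | i ∈ ω.1} =
      (∑ A, independentMass x A * probOf (π A) {J | i ∈ J}) / x i := by
  have hmass : ∀ A, (randomSet x hx A).toReal = independentMass x A := fun A => by
    simp [randomSet, independentMass_nonneg hx]
  rw [condProbOf, probOf_jointLaw, probOf_jointLaw]
  simp only [hmass]
  congr 1
  · refine Finset.sum_congr rfl fun A _ => ?_
    by_cases h : i ∈ A
    · simp [h]
    · have : probOf (π A) {J | i ∈ J} = 0 := by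
        rw [probOf, (PMF.toOuterMeasure_apply_eq_zero_iff _ _).2, ENNReal.toReal_zero]
        exact Set.disjoint_left.2 fun J hJ hi => h (hπ A J hJ hi)
      rw [this]
      simp [h, probOf_empty]
  · rw [← bernoulliExp_mem x (Finset.mem_univ i), ← sum_independentMass_mul]
    refine Finset.sum_congr rfl fun A _ => ?_
    by_cases h : i ∈ A
    · simp [h, probOf_univ]
    · simp [h, probOf_empty]

/-- The upper bound is Bernoulli's inequality `(1 - b/n)^n ≥ 1 - b`. -/
theorem balance_ratio_mem_Icc {b : ℝ} (hb0 : 0 < b) (hb1 : b ≤ 1) (n : ℕ) :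
    (1 - (1 - b / n) ^ n) / b ∈ Set.Icc (0 : ℝ) 1 := by
  rcases n.eq_zero_or_pos with rfl | hn
  · simp
  have h1 : (1 : ℝ) ≤ n := by exact_mod_cast hn
  have h2 : b / n ≤ 1 := (div_le_one (by linarith)).2 (by linarith)
  have h3 : 0 ≤ b / n := by positivity
  refine ⟨div_nonneg (sub_nonneg.2 (pow_le_one₀ (by linarith) (by linarith))) hb0.le, ?_⟩
  rw [div_le_one hb0]
  have := one_add_mul_le_pow (show (-2 : ℝ) ≤ -(b / n) by linarith) n
  rw [mul_neg, mul_div_cancel₀ _ (by linarith : (n : ℝ) ≠ 0), ← sub_eq_add_neg,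
    ← sub_eq_add_neg] at this
  linarith

theorem mainTheorem4 {N : Type*} [Fintype N] [DecidableEq N] (M : Matroid N)
    (hM : M.E = Set.univ) (b : ℝ) (hb0 : 0 < b) (hb1 : b ≤ 1) :
    ∃ π : (N → ℝ) → Finset N → PMF (Finset N),
      IsBalancedCRScheme (indepSets M) b
        ((1 - (1 - b / (Fintype.card N : ℝ)) ^ Fintype.card N) / b) π := by
  have hex : ∀ x : N → ℝ, ∃ π : Finset N → PMF (Finset N),
      x ∈ b • feasiblePolytope (indepSets M) →
        (∀ A, ∀ J ∈ (π A).support, J ∈ indepSets M ∧ ∀ i ∈ J, i ∈ A ∧ 0 < x i) ∧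
        ∀ i, (1 - (1 - b / (Fintype.card N : ℝ)) ^ Fintype.card N) / b * x i ≤
          ∑ A, independentMass x A * probOf (π A) {J | i ∈ J} := by
    intro x
    by_cases hx : x ∈ b • feasiblePolytope (indepSets M)
    · obtain ⟨z, hz, hzx⟩ := M.exists_marginals hb0 hb1 hx
      choose π hπ hπz using fun A => exists_pmf_of_mem_feasiblePolytope (hz A)
      exact ⟨π, fun _ => ⟨hπ, by simpa only [hπz] using hzx⟩⟩
    -- Arbitrary value: nothing is required of the scheme outside `b P_I`.
    · exact ⟨fun _ => PMF.pure ∅, fun h => absurd h hx⟩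
  choose π hπ using hex
  refine ⟨π, ⟨hb0.le, hb1⟩, balance_ratio_mem_Icc hb0 hb1 _,
    fun x hx A J hJ => ((hπ x hx).1 A J hJ).2, fun x hx A J hJ => ((hπ x hx).1 A J hJ).1,
    fun x hx i hi => ?_⟩
  rw [condProbOf_jointLaw_randomSet _ _ fun A J hJ j hj => (((hπ x hx).1 A J hJ).2 j hj).1,
    le_div_iff₀ hi]
  exact (hπ x hx).2 i
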